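/- For a nonzero Laurent polynomial $f\in\mathbb C[z,z^{-1}]$ let $M(f)=\exp\left(\int_0^1\log|f(e^{2\pi i t})|\,dt\right)$ be its Mahler measure (with $M(0)=0$), and let the height $h(f)$ be the maximum modulus of the coefficients of $f$. Fix an integer $k\ge 1$. Then there are only finitely many tuples of integers $(a_1,\dots,a_k)$ for which there exist pairwise distinct nonzero integers $n_1,\dots,n_{k-1}$ (which may be negative) such that $$f(z)=a_1z^{n_1}+\cdots+a_{k-1}z^{n_{k-1}}+a_k$$ has $M(f)=1$. (The $a_i$ are allowed to be $0$.) Moreover, if $k\ge 2$, then every $f$ of this form with $M(f)=1$ has height $h(f)\le 2^{k-2}$. -/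

import Mathlib

noncomputable section

/-- The value `F(e^{2πit})` of a complex Laurent polynomial at a point of the unit circle. -/
def laurentCircleEval (F : LaurentPolynomial ℂ) (t : ℝ) : ℂ :=
  LaurentPolynomial.eval₂ (RingHom.id ℂ) (Circle.toUnits (Circle.exp (2 * Real.pi * t))) F

/-- The logarithmic Mahler measure `m(F) = ∫₀¹ log |F(e^{2πit})| dt`. -/
def laurentLogMahlerMeasure (F : LaurentPolynomial ℂ) : ℝ :=
  ∫ t in (0 : ℝ)..1, Real.log ‖laurentCircleEval F t‖

open Classical in
/-- The Mahler measure `M(F) = exp (m(F))`, with the usual convention `M(0) = 0`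
(corresponding to `m(0) = -∞`). -/
def laurentMahlerMeasure (F : LaurentPolynomial ℂ) : ℝ :=
  if F = 0 then 0 else Real.exp (laurentLogMahlerMeasure F)

/-- The height of a Laurent polynomial: the maximum modulus of its coefficients. -/
def laurentHeight (F : LaurentPolynomial ℂ) : NNReal :=
  F.coeff.support.sup fun j => ‖F.coeff j‖₊

/-- The Laurent polynomial `a₁ z^{n₁} + ⋯ + a_k z^{n_k}` with integer coefficients `a`
and integer exponents `n`. -/
def laurentOfTuple {k : ℕ} (a n : Fin k → ℤ) : LaurentPolynomial ℂ :=
  ∑ i, LaurentPolynomial.C (a i : ℂ) * LaurentPolynomial.T (n i)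

/-- On ordinary polynomials the Mahler measure above is Mathlib's `Polynomial.mahlerMeasure`. -/
theorem laurentMahlerMeasure_toLaurent (p : Polynomial ℂ) :
    laurentMahlerMeasure (Polynomial.toLaurent p) = p.mahlerMeasure := by
  by_cases hp : p = 0
  · simp [hp, laurentMahlerMeasure]
  · have key : ∀ t : ℝ, laurentCircleEval (Polynomial.toLaurent p) t
        = p.eval (circleMap 0 1 (t * (2 * Real.pi))) := by
      intro t
      rw [laurentCircleEval, LaurentPolynomial.eval₂_toLaurent, ← Polynomial.eval]
      congr 1
      simp [circleMap, Circle.coe_exp, mul_comm]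
    rw [Polynomial.mahlerMeasure_def_of_ne_zero hp, laurentMahlerMeasure,
      if_neg (by simpa using hp), laurentLogMahlerMeasure]
    simp_rw [key]
    rw [intervalIntegral.integral_comp_mul_right
      (fun x => Real.log ‖p.eval (circleMap 0 1 x)‖) (by positivity)]
    simp

end

/-! Sparsity alone bounds coefficients: with at most k ≥ 2 monomials, each is at most 2^(k-2) M(p)
in modulus, so integer coefficients with M = 1 lie in a finite box. The bound is by induction on the
number of monomials. If the constant term is nonzero, differentiation removes a monomial and
multiplies a_i by i, while Mahler's inequality gives M(p') ≤ n M(p) for n = deg p. The cost is n/i,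
at most 2 when i ≥ n/2; reversal preserves M and swaps i with n - i, covering the other half. For
Mahler's inequality, reflect the roots outside the unit disc. On the circle |p| is unchanged and
|p'| does not decrease. Now all roots lie in the disc, hence by Gauss–Lucas so do those of the
derivative, and both measures are moduli of leading coefficients. -/

/-! ### Reflecting roots into the unit disc -/

open Polynomial in
/-- The Mahler measure is monotone in the modulus of the polynomial on the unit circle; the zeros
of an auxiliary nonzero polynomial may be ignored. -/
theorem mahlerMeasure_le_of_norm_eval_le {p q r : ℂ[X]} (hr : r ≠ 0)
    (h : ∀ z : ℂ, ‖z‖ = 1 → r.eval z ≠ 0 → ‖p.eval z‖ ≤ ‖q.eval z‖) (hq : q ≠ 0) :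
    p.mahlerMeasure ≤ q.mahlerMeasure := by
  by_cases hp : p = 0
  · simpa [hp] using q.mahlerMeasure_nonneg
  rw [mahlerMeasure_def_of_ne_zero hp, mahlerMeasure_def_of_ne_zero hq]
  gcongr
  apply intervalIntegral.integral_mono_ae (by positivity) p.intervalIntegrable_mahlerMeasure
    q.intervalIntegrable_mahlerMeasure
  -- Zeros of `p` must go too: `Real.log 0 = 0` would break monotonicity there.
  have hc : (circleMap (0 : ℂ) 1 ⁻¹' {z | (p * r).eval z = 0}).Countable := by
    refine Set.Countable.preimage_circleMap ?_ 0 one_ne_zero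
    refine ((p * r).roots.finite_toSet.subset ?_).countable
    intro z hz
    exact (mem_roots (mul_ne_zero hp hr)).2 hz
  filter_upwards [hc.ae_notMem MeasureTheory.volume] with x hx
  have hx' : p.eval (circleMap 0 1 x) ≠ 0 ∧ r.eval (circleMap 0 1 x) ≠ 0 := by
    simpa [not_or] using hx
  exact Real.log_le_log (norm_pos_iff.2 hx'.1) (h _ (by simp) hx'.2)

open Polynomial in
/-- The linear factor with root `α`, if `α` lies in the closed unit disc, and otherwise the linear
polynomial of the same modulus on the unit circle whose root is the reflection of `α`. -/
noncomputable def reflectedFactor (α : ℂ) : ℂ[X] :=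
  if ‖α‖ ≤ 1 then X - C α else 1 - C (starRingEnd ℂ α) * X

open Polynomial in
theorem natDegree_reflectedFactor (α : ℂ) : (reflectedFactor α).natDegree = 1 := by
  unfold reflectedFactor
  split_ifs with h
  · exact natDegree_X_sub_C α
  · have hα : -(starRingEnd ℂ α) ≠ 0 := by
      rintro h0
      have : α = 0 := by simpa using h0
      simp [this] at h
    rw [show (1 : ℂ[X]) - C (starRingEnd ℂ α) * X = C (-(starRingEnd ℂ α)) * X + C 1 by
      simp; ring]
    exact natDegree_linear hα

open Polynomial in
theorem mahlerMeasure_reflectedFactor (α : ℂ) :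
    (reflectedFactor α).mahlerMeasure = max 1 ‖α‖ := by
  unfold reflectedFactor
  split_ifs with h
  · exact mahlerMeasure_X_sub_C α
  · have hα : -(starRingEnd ℂ α) ≠ 0 := by
      rintro h0
      have : α = 0 := by simpa using h0
      simp [this] at h
    rw [show (1 : ℂ[X]) - C (starRingEnd ℂ α) * X = C (-(starRingEnd ℂ α)) * X + C 1 by
      simp; ring, mahlerMeasure_C_mul_X_add_C hα]
    simp [max_comm]

open Polynomial in
theorem norm_le_one_of_eval_reflectedFactor_eq_zero {α z : ℂ}
    (h : (reflectedFactor α).eval z = 0) : ‖z‖ ≤ 1 := by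
  unfold reflectedFactor at h
  split_ifs at h with hα
  · have : z = α := by simpa [sub_eq_zero] using h
    rwa [this]
  · have h1 : (starRingEnd ℂ α) * z = 1 := by
      have : 1 - (starRingEnd ℂ α) * z = 0 := by simpa using h
      linear_combination -this
    have h2 : ‖α‖ * ‖z‖ = 1 := by simpa using congrArg norm h1
    nlinarith [norm_nonneg z]

/-- On the unit circle, `z / (z - α)` has real part at least `1 / 2` exactly when `‖α‖ ≤ 1`. -/
theorem re_div_sub_sub_half {z α : ℂ} (hz : ‖z‖ = 1) (h : z - α ≠ 0) :
    (z / (z - α)).re - 1 / 2 = (1 - ‖α‖ ^ 2) / (2 * Complex.normSq (z - α)) := by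
  have hn : Complex.normSq (z - α) ≠ 0 := by simpa using h
  have hz2 : z.re * z.re + z.im * z.im = 1 := by
    rw [← Complex.normSq_apply, Complex.normSq_eq_norm_sq, hz]; norm_num
  rw [← Complex.normSq_eq_norm_sq, Complex.div_re]
  field_simp
  simp only [Complex.normSq_apply, Complex.sub_re, Complex.sub_im]
  linear_combination hz2

open Polynomial in
-- Reflection replaces w = z / (z - α) by 1 - conj w. This keeps Im w and mirrors Re w in 1/2,
-- moving it to the side Re ≥ 1/2, where it dominates its mirror image in modulus.
theorem reflectedFactor_on_circle {z α : ℂ} (hz : ‖z‖ = 1) (h : z - α ≠ 0) :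
    ‖(reflectedFactor α).eval z‖ = ‖z - α‖ ∧
    |(z / (z - α)).re| ≤
      (z * (reflectedFactor α).derivative.eval z / (reflectedFactor α).eval z).re ∧
    (z / (z - α)).im =
      (z * (reflectedFactor α).derivative.eval z / (reflectedFactor α).eval z).im := by
  have hre := re_div_sub_sub_half hz h
  have hn : 0 < Complex.normSq (z - α) := by simpa [Complex.normSq_pos] using h
  unfold reflectedFactor
  split_ifs with hα
  · have : 0 ≤ (1 - ‖α‖ ^ 2) / (2 * Complex.normSq (z - α)) := by
      apply div_nonneg _ (by positivity)
      nlinarith [norm_nonneg α]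
    simp only [eval_sub, eval_X, eval_C, derivative_sub, derivative_X, derivative_C, sub_zero,
      eval_one, mul_one, and_true, true_and]
    rw [abs_of_nonneg (by linarith)]
  · have hneg : (1 - ‖α‖ ^ 2) / (2 * Complex.normSq (z - α)) ≤ 0 := by
      apply div_nonpos_of_nonpos_of_nonneg _ (by positivity)
      nlinarith [norm_nonneg α]
    have hzz : z * (starRingEnd ℂ z) = 1 := by
      rw [Complex.mul_conj, Complex.normSq_eq_norm_sq, hz]; norm_num
    have hev : 1 - (starRingEnd ℂ α) * z = z * (starRingEnd ℂ (z - α)) := by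
      rw [map_sub]; linear_combination -hzz
    have hz0 : z ≠ 0 := by rintro rfl; simp at hz
    have hc : starRingEnd ℂ (z - α) ≠ 0 := (_root_.map_ne_zero _).2 h
    have hquot : z * (-(starRingEnd ℂ α)) / (1 - (starRingEnd ℂ α) * z)
        = 1 - (starRingEnd ℂ (z / (z - α))) := by
      rw [hev, map_div₀]
      field_simp
      rw [map_sub]; ring
    have hder : (derivative ((1 : ℂ[X]) - C (starRingEnd ℂ α) * X)).eval z
        = -(starRingEnd ℂ α) := by simp
    have hval : ((1 : ℂ[X]) - C (starRingEnd ℂ α) * X).eval z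
        = 1 - (starRingEnd ℂ α) * z := by simp
    rw [hder, hval, hquot]
    refine ⟨?_, ?_, ?_⟩
    · rw [hev, norm_mul, hz, one_mul, RCLike.norm_conj]
    · rw [Complex.sub_re, Complex.conj_re, Complex.one_re, abs_le]
      constructor <;> linarith
    · rw [Complex.sub_im, Complex.conj_im, Complex.one_im, zero_sub, neg_neg]

open Polynomial in
-- Logarithmic derivatives add over factors, and so do the one-factor estimates.
theorem reflectedFactor_prod_on_circle (s : Multiset ℂ) {z : ℂ} (hz : ‖z‖ = 1)
    (h : ((s.map fun α ↦ X - C α).prod).eval z ≠ 0) :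
    let q := (s.map fun α ↦ X - C α).prod
    let g := (s.map reflectedFactor).prod
    ‖g.eval z‖ = ‖q.eval z‖ ∧
    |(z * q.derivative.eval z / q.eval z).re| ≤ (z * g.derivative.eval z / g.eval z).re ∧
    (z * q.derivative.eval z / q.eval z).im = (z * g.derivative.eval z / g.eval z).im := by
  have key : ∀ u v : ℂ[X], u.eval z ≠ 0 → v.eval z ≠ 0 →
      z * (u * v).derivative.eval z / (u * v).eval z
        = z * u.derivative.eval z / u.eval z + z * v.derivative.eval z / v.eval z := by
    intro u v hu hv
    simp only [derivative_mul, eval_add, eval_mul]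
    field_simp
  induction s using Multiset.induction_on with
  | empty => simp
  | cons α s ih =>
    simp only [Multiset.map_cons, Multiset.prod_cons, eval_mul] at h ⊢
    obtain ⟨h1, h2⟩ := mul_ne_zero_iff.1 h
    obtain ⟨i1, i2, i3⟩ := ih h2
    have h1' : z - α ≠ 0 := by simpa using h1
    obtain ⟨j1, j2, j3⟩ := reflectedFactor_on_circle hz h1'
    have hg : (s.map reflectedFactor).prod.eval z ≠ 0 := by
      rw [← norm_pos_iff, i1]; exact norm_pos_iff.2 h2
    have hf : (reflectedFactor α).eval z ≠ 0 := by
      rw [← norm_pos_iff, j1]; exact norm_pos_iff.2 h1'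
    have e1 := key (X - C α) _ h1 h2
    have e2 := key _ _ hf hg
    rw [eval_mul] at e1 e2
    rw [e1, e2]
    have e3 : z * (X - C α).derivative.eval z / (X - C α).eval z = z / (z - α) := by simp
    rw [e3]
    refine ⟨?_, ?_, ?_⟩
    · simp [j1, i1]
    · rw [Complex.add_re, Complex.add_re]
      exact (abs_add_le _ _).trans (add_le_add j2 i2)
    · rw [Complex.add_im, Complex.add_im, j3, i3]

/-! ### Mahler's inequality for the derivative -/

open Polynomial in
/-- If all roots lie in the closed unit disc, the Mahler measure is the modulus of the leading
coefficient. -/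
theorem mahlerMeasure_eq_norm_leadingCoeff {p : ℂ[X]} (h : ∀ z, p.IsRoot z → ‖z‖ ≤ 1) :
    p.mahlerMeasure = ‖p.leadingCoeff‖ := by
  rw [mahlerMeasure_eq_leadingCoeff_mul_prod_roots]
  have : p.roots.map (fun a ↦ max 1 ‖a‖) = p.roots.map (fun _ ↦ (1 : ℝ)) := by
    refine Multiset.map_congr rfl fun a ha ↦ max_eq_left (h a (isRoot_of_mem_roots ha))
  simp [this]

open Polynomial in
theorem mahlerMeasure_derivative_of_norm_roots_le_one {p : ℂ[X]}
    (h : ∀ z, p.IsRoot z → ‖z‖ ≤ 1) :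
    p.derivative.mahlerMeasure = p.natDegree * p.mahlerMeasure := by
  rcases Nat.eq_zero_or_pos p.natDegree with h0 | h0
  · rw [eq_C_of_natDegree_eq_zero h0]; simp
  have hd : 0 < p.degree := natDegree_pos_iff_degree_pos.1 h0
  have hsub : convexHull ℝ (p.rootSet ℂ) ⊆ Metric.closedBall 0 1 := by
    refine convexHull_min ?_ (convex_closedBall _ _)
    intro z hz
    rw [mem_rootSet, coe_aeval_eq_eval] at hz
    simpa using h z hz.2
  have hd0 : p.derivative ≠ 0 := by
    intro hp
    have := derivative_eq_zero.1 hp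
    omega
  have h' : ∀ z, p.derivative.IsRoot z → ‖z‖ ≤ 1 := by
    intro z hz
    have := hsub (rootSet_derivative_subset_convexHull_rootSet hd
      (by rw [mem_rootSet, coe_aeval_eq_eval]; exact ⟨hd0, hz⟩))
    simpa using this
  rw [mahlerMeasure_eq_norm_leadingCoeff h, mahlerMeasure_eq_norm_leadingCoeff h']
  have hl : p.derivative.leadingCoeff = p.leadingCoeff * p.natDegree := by
    rw [leadingCoeff, natDegree_derivative, coeff_derivative, leadingCoeff,
      Nat.sub_add_cancel h0]
    congr 1
    rw [← Nat.cast_add_one, Nat.sub_add_cancel h0]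
  rw [hl, norm_mul, mul_comm]
  simp

open Polynomial in
/-- **Mahler's inequality** for the Mahler measure of the derivative. -/
theorem mahlerMeasure_derivative_le (p : ℂ[X]) :
    p.derivative.mahlerMeasure ≤ p.natDegree * p.mahlerMeasure := by
  by_cases hp : p = 0
  · simp [hp]
  set q := (p.roots.map fun α ↦ X - C α).prod with hq
  set g := (p.roots.map reflectedFactor).prod with hg
  have hpq : p = C p.leadingCoeff * q := (IsAlgClosed.splits p).eq_prod_roots
  have hq0 : q ≠ 0 := by rintro h; rw [h] at hpq; simp at hpq; exact hp hpq
  have hf0 : (0 : ℂ[X]) ∉ p.roots.map reflectedFactor := by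
    intro h
    obtain ⟨α, -, hα⟩ := Multiset.mem_map.1 h
    have := natDegree_reflectedFactor α
    simp [hα] at this
  have hg0 : g ≠ 0 := Multiset.prod_ne_zero hf0
  have hgroots : ∀ z, g.IsRoot z → ‖z‖ ≤ 1 := by
    intro z hz
    rw [IsRoot.def, hg, eval_multiset_prod, Multiset.prod_eq_zero_iff, Multiset.map_map] at hz
    obtain ⟨α, -, hα⟩ := Multiset.mem_map.1 hz
    exact norm_le_one_of_eval_reflectedFactor_eq_zero hα
  have hgdeg : g.natDegree = p.natDegree := by
    rw [hg, natDegree_multiset_prod _ hf0, Multiset.map_map]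
    simp only [Function.comp_def, natDegree_reflectedFactor, Multiset.map_const',
      Multiset.sum_replicate, smul_eq_mul, mul_one]
    exact splits_iff_card_roots.1 (IsAlgClosed.splits p)
  have hM : g.mahlerMeasure = q.mahlerMeasure := by
    simp [hg, hq, Multiset.map_map, mahlerMeasure_reflectedFactor]
  have hle : q.derivative.mahlerMeasure ≤ g.derivative.mahlerMeasure := by
    -- The comparison needs `g.derivative ≠ 0`, which fails in degree zero.
    by_cases hn : p.natDegree = 0
    · have h1 : p.roots = 0 := by
        rw [← Multiset.card_eq_zero]
        exact Nat.le_zero.1 (hn ▸ p.card_roots')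
      simp [hq, hg, h1]
    refine mahlerMeasure_le_of_norm_eval_le hq0 ?_ ?_
    · intro z hz hqz
      obtain ⟨h1, h2, h3⟩ := reflectedFactor_prod_on_circle p.roots hz hqz
      have hgz : g.eval z ≠ 0 := by
        rw [← norm_pos_iff, h1]; exact norm_pos_iff.2 hqz
      have h4 : ‖z * q.derivative.eval z / q.eval z‖ ≤ ‖z * g.derivative.eval z / g.eval z‖ := by
        rw [← sq_le_sq₀ (norm_nonneg _) (norm_nonneg _), ← Complex.normSq_eq_norm_sq,
          ← Complex.normSq_eq_norm_sq, Complex.normSq_apply, Complex.normSq_apply]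
        have := sq_le_sq' (neg_le_of_abs_le h2) (le_of_abs_le h2)
        rw [h3]
        nlinarith
      rw [norm_div, norm_div, norm_mul, norm_mul, hz, one_mul, one_mul, h1] at h4
      exact (div_le_div_iff_of_pos_right (norm_pos_iff.2 hqz)).1 h4
    · intro h
      exact hn (hgdeg ▸ derivative_eq_zero.1 h)
  have hqg : q.derivative.mahlerMeasure ≤ p.natDegree * q.mahlerMeasure := by
    rw [← hM, ← hgdeg, ← mahlerMeasure_derivative_of_norm_roots_le_one hgroots]
    exact hle
  have e1 : p.derivative.mahlerMeasure = ‖p.leadingCoeff‖ * q.derivative.mahlerMeasure := by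
    conv_lhs => rw [hpq]
    rw [derivative_C_mul, mahlerMeasure_mul, mahlerMeasure_const]
  have e2 : p.mahlerMeasure = ‖p.leadingCoeff‖ * q.mahlerMeasure := by
    conv_lhs => rw [hpq]
    rw [mahlerMeasure_mul, mahlerMeasure_const]
  rw [e1, e2, mul_left_comm]
  gcongr

/-! ### Coefficients of sparse polynomials -/

open Polynomial in
theorem mahlerMeasure_reverse (p : ℂ[X]) : p.reverse.mahlerMeasure = p.mahlerMeasure := by
  have hlin : ∀ α : ℂ, (X - C α).reverse.mahlerMeasure = max 1 ‖α‖ := by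
    intro α
    have : (X - C α).reverse = 1 - C α * X := by
      rw [sub_eq_add_neg, ← C_neg, reverse_add_C]
      have : (X : ℂ[X]).reverse = 1 := by
        rw [← mul_one (X : ℂ[X]), reverse_X_mul, ← C_1, reverse_C]
      simp [this, sub_eq_add_neg]
    rw [this]
    by_cases hα : α = 0
    · simp [hα]
    · rw [show (1 : ℂ[X]) - C α * X = C (-α) * X + C 1 by simp; ring,
        mahlerMeasure_C_mul_X_add_C (neg_ne_zero.2 hα)]
      simp [max_comm]
  have hprod : ∀ s : Multiset ℂ, ((s.map fun α ↦ X - C α).prod).reverse.mahlerMeasure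
      = (s.map fun α ↦ max 1 ‖α‖).prod := by
    intro s
    induction s using Multiset.induction_on with
    | empty =>
      have : (1 : ℂ[X]).reverse = 1 := reverse_C 1
      simp [this]
    | cons α s ih => simp [mahlerMeasure_mul, hlin, ih]
  rw [mahlerMeasure_eq_leadingCoeff_mul_prod_roots p]
  conv_lhs => rw [(IsAlgClosed.splits p).eq_prod_roots]
  rw [reverse_mul_of_domain, mahlerMeasure_mul, reverse_C, mahlerMeasure_const, hprod]

open Polynomial in
theorem card_support_reverse_le {R : Type*} [Semiring R] (p : R[X]) :
    p.reverse.support.card ≤ p.support.card := by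
  rw [reverse, reflect_support]
  exact Finset.card_image_le

open Polynomial in
theorem card_support_derivative_lt {R : Type*} [Semiring R] {p : R[X]} (h : p.coeff 0 ≠ 0) :
    p.derivative.support.card < p.support.card := by
  have hsub : p.derivative.support.image (· + 1) ⊆ p.support.erase 0 := by
    intro i hi
    obtain ⟨j, hj, rfl⟩ := Finset.mem_image.1 hi
    simp only [Finset.mem_erase, mem_support_iff]
    refine ⟨by omega, fun h0 ↦ ?_⟩
    rw [mem_support_iff, coeff_derivative, h0, zero_mul] at hj
    exact hj rfl
  have h1 := Finset.card_le_card hsub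
  rw [Finset.card_image_of_injective _ (add_left_injective 1)] at h1
  exact h1.trans_lt (Finset.card_erase_lt_of_mem (by simpa using h))

open Polynomial in
/-- A coefficient of `p` is a coefficient of its reverse. -/
theorem exists_coeff_reverse_eq {R : Type*} [Semiring R] (p : R[X]) (i : ℕ) :
    ∃ j, p.reverse.coeff j = p.coeff i :=
  ⟨revAt p.natDegree i, by rw [coeff_reverse, revAt_invol]⟩

open Polynomial in
/-- Every coefficient of a complex polynomial with at most `k + 2` monomials has modulus at most
`2 ^ k` times the Mahler measure. -/
theorem norm_coeff_le_two_pow_mul_mahlerMeasure (k : ℕ) (p : ℂ[X])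
    (hp : p.support.card ≤ k + 2) (i : ℕ) : ‖p.coeff i‖ ≤ 2 ^ k * p.mahlerMeasure := by
  -- The constant term of the reverse is the leading coefficient, hence nonzero.
  suffices H : ∀ p : ℂ[X], p.coeff 0 ≠ 0 → p.support.card ≤ k + 2 →
      ∀ i, ‖p.coeff i‖ ≤ 2 ^ k * p.mahlerMeasure by
    by_cases h0 : p = 0
    · simp [h0]
    obtain ⟨j, hj⟩ := exists_coeff_reverse_eq p i
    rw [← hj, ← mahlerMeasure_reverse]
    exact H _ (by simpa using h0) ((card_support_reverse_le p).trans hp) j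
  clear hp p i
  induction k with
  | zero =>
    intro p h0 hp i
    rw [pow_zero, one_mul]
    by_cases hi : p.coeff i = 0
    · simpa [hi] using p.mahlerMeasure_nonneg
    rcases eq_or_ne i p.natDegree with rfl | hin
    · exact p.leadingCoeff_le_mahlerMeasure
    rcases eq_or_ne i 0 with rfl | hi0
    · have h1 := p.reverse.leadingCoeff_le_mahlerMeasure
      rw [mahlerMeasure_reverse, reverse_leadingCoeff, trailingCoeff,
        natTrailingDegree_eq_zero.2 (Or.inr h0)] at h1
      exact h1
    -- A nonzero coefficient strictly between the ends would be a third monomial.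
    exfalso
    have hn0 : p.natDegree ≠ 0 := by
      have := le_natDegree_of_ne_zero hi
      omega
    have hsub : ({0, i, p.natDegree} : Finset ℕ) ⊆ p.support := by
      intro j hj
      simp only [Finset.mem_insert, Finset.mem_singleton] at hj
      rw [mem_support_iff]
      rcases hj with rfl | rfl | rfl
      · exact h0
      · exact hi
      · rw [coeff_natDegree, leadingCoeff_ne_zero]
        rintro rfl
        simp at h0
    have := Finset.card_le_card hsub
    rw [Finset.card_eq_three.2 ⟨0, i, p.natDegree, hi0.symm, hn0.symm, hin, rfl⟩] at this
    omega
  | succ k ih =>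
    have large : ∀ p : ℂ[X], p.coeff 0 ≠ 0 → p.support.card ≤ k + 1 + 2 →
        ∀ i, p.natDegree ≤ 2 * i → ‖p.coeff i‖ ≤ 2 ^ (k + 1) * p.mahlerMeasure := by
      intro p h0 hp i hi
      have hM := p.mahlerMeasure_nonneg
      rcases Nat.eq_zero_or_pos i with rfl | hipos
      · have hn : p.natDegree = 0 := by omega
        have h1 := p.leadingCoeff_le_mahlerMeasure
        rw [leadingCoeff, hn] at h1
        exact h1.trans (le_mul_of_one_le_left hM (one_le_pow₀ one_le_two))
      obtain ⟨i, rfl⟩ : ∃ j, i = j + 1 := ⟨i - 1, by omega⟩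
      have hcard : p.derivative.support.card ≤ k + 2 := by
        have := card_support_derivative_lt h0
        omega
      have hder : ‖p.derivative.coeff i‖ ≤ 2 ^ k * p.derivative.mahlerMeasure := by
        by_cases hd : p.derivative = 0
        · simp [hd]
        -- The derivative may vanish at 0, so the induction hypothesis is applied to its reverse.
        obtain ⟨j, hj⟩ := exists_coeff_reverse_eq p.derivative i
        rw [← hj, ← mahlerMeasure_reverse]
        exact ih _ (by rwa [coeff_zero_reverse, leadingCoeff_ne_zero]) ((card_support_reverse_le _).trans hcard) j
      rw [coeff_derivative, norm_mul] at hder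
      have hcast : ‖((i : ℂ) + 1)‖ = (i : ℝ) + 1 := by
        rw [← Nat.cast_add_one, Complex.norm_natCast]; push_cast; rfl
      rw [hcast] at hder
      have hi' : (p.natDegree : ℝ) ≤ 2 * ((i : ℝ) + 1) := by exact_mod_cast hi
      have hchain : ‖p.coeff (i + 1)‖ * ((i : ℝ) + 1)
          ≤ (2 ^ (k + 1) * p.mahlerMeasure) * ((i : ℝ) + 1) := by
        calc _ ≤ 2 ^ k * (p.natDegree * p.mahlerMeasure) :=
              hder.trans (by gcongr; exact mahlerMeasure_derivative_le p)
          _ ≤ 2 ^ k * ((2 * ((i : ℝ) + 1)) * p.mahlerMeasure) := by gcongr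
          _ = _ := by ring
      exact le_of_mul_le_mul_right hchain (by positivity)
    intro p h0 hp i
    rcases le_or_gt p.natDegree (2 * i) with hi | hi
    · exact large p h0 hp i hi
    · have hp0 : p ≠ 0 := by rintro rfl; simp at h0
      -- Index i in the lower half becomes n - i in the upper half.
      have h1 := large p.reverse (by simpa using hp0)
        ((card_support_reverse_le p).trans hp) (p.natDegree - i)
        ((reverse_natDegree_le p).trans (by omega))
      rwa [mahlerMeasure_reverse, coeff_reverse, revAt_le (by omega),
        Nat.sub_sub_self (by omega)] at h1

/-! ### Laurent polynomials and the theorem -/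

/-- Multiplication by a monomial does not change the Mahler measure. -/
theorem laurentMahlerMeasure_T_mul (m : ℤ) (F : LaurentPolynomial ℂ) :
    laurentMahlerMeasure (LaurentPolynomial.T m * F) = laurentMahlerMeasure F := by
  have hzero : LaurentPolynomial.T m * F = 0 ↔ F = 0 :=
    (LaurentPolynomial.isUnit_T m).mul_right_eq_zero
  have heval : ∀ t, ‖laurentCircleEval (LaurentPolynomial.T m * F) t‖
      = ‖laurentCircleEval F t‖ := by
    intro t
    rw [laurentCircleEval, laurentCircleEval, map_mul, norm_mul, LaurentPolynomial.eval₂_T]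
    rw [Units.val_zpow_eq_zpow_val, norm_zpow, Circle.toUnits_apply, Units.val_mk0,
      Circle.norm_coe, one_zpow, one_mul]
  simp only [laurentMahlerMeasure, laurentLogMahlerMeasure, hzero, heval]

theorem coeff_laurentOfTuple {k : ℕ} (a n : Fin k → ℤ) (j : ℤ) :
    (laurentOfTuple a n).coeff j = ∑ i, if n i = j then (a i : ℂ) else 0 := by
  simp_rw [laurentOfTuple, ← LaurentPolynomial.single_eq_C_mul_T, AddMonoidAlgebra.coeff_sum,
    Finsupp.finsetSum_apply, AddMonoidAlgebra.coeff_single, Finsupp.single_apply]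

open Polynomial in
theorem norm_le_two_pow_mul_laurentMahlerMeasure {k : ℕ} (a n : Fin (k + 2) → ℤ)
    (hn : Function.Injective n) (i : Fin (k + 2)) :
    ‖(a i : ℂ)‖ ≤ 2 ^ k * laurentMahlerMeasure (laurentOfTuple a n) := by
  -- A shift large enough to make every exponent nonnegative.
  set m : ℤ := ∑ i, |n i| with hm
  have hnm : ∀ i, 0 ≤ m + n i := by
    intro i
    have h1 : |n i| ≤ m := Finset.single_le_sum (f := fun i ↦ |n i|)
      (fun j _ ↦ abs_nonneg (n j)) (Finset.mem_univ i)
    have := neg_abs_le (n i)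
    omega
  set p : ℂ[X] := ∑ i, C (a i : ℂ) * X ^ (m + n i).toNat with hp
  have hlaur : toLaurent p = LaurentPolynomial.T m * laurentOfTuple a n := by
    rw [hp, laurentOfTuple, map_sum, Finset.mul_sum]
    refine Finset.sum_congr rfl fun j _ ↦ ?_
    rw [toLaurent_C_mul_X_pow, Int.toNat_of_nonneg (hnm j), LaurentPolynomial.T_add]
    ring
  rw [← laurentMahlerMeasure_T_mul m, ← hlaur, laurentMahlerMeasure_toLaurent]
  have hcoeff : p.coeff (m + n i).toNat = a i := by
    rw [hp, finsetSum_coeff, Finset.sum_eq_single i]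
    · simp
    · intro j _ hj
      rw [coeff_C_mul_X_pow, if_neg]
      intro h
      apply hj
      apply hn
      have := hnm i
      have := hnm j
      omega
    · simp
  rw [← hcoeff]
  refine norm_coeff_le_two_pow_mul_mahlerMeasure k p ?_ _
  have hsub : p.support ⊆ Finset.univ.image fun i ↦ (m + n i).toNat := by
    intro j hj
    by_contra hj'
    rw [mem_support_iff, hp, finsetSum_coeff] at hj
    apply hj
    refine Finset.sum_eq_zero fun l _ ↦ ?_
    rw [coeff_C_mul_X_pow, if_neg]
    rintro rfl
    exact hj' (Finset.mem_image_of_mem _ (Finset.mem_univ l))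
  exact (Finset.card_le_card hsub).trans (Finset.card_image_le.trans (by simp))

theorem laurentMahlerMeasure_C_mul_T (a : ℂ) (m : ℤ) :
    laurentMahlerMeasure (LaurentPolynomial.C a * LaurentPolynomial.T m) = ‖a‖ := by
  rw [mul_comm, laurentMahlerMeasure_T_mul, ← Polynomial.toLaurent_C,
    laurentMahlerMeasure_toLaurent, Polynomial.mahlerMeasure_const]

theorem norm_le_of_laurentMahlerMeasure_eq_one {k : ℕ} {a n : Fin k → ℤ}
    (hn : Function.Injective n) (h : laurentMahlerMeasure (laurentOfTuple a n) = 1) (i : Fin k) :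
    ‖(a i : ℂ)‖ ≤ 2 ^ (k - 2) := by
  match k with
  | 0 => exact i.elim0
  -- Here `k - 2` truncates to 0, and the single coefficient has modulus M = 1.
  | 1 =>
    rw [laurentOfTuple, Fin.sum_univ_one, laurentMahlerMeasure_C_mul_T] at h
    rw [Subsingleton.elim i 0, h]
    norm_num
  | k + 2 => simpa [h] using norm_le_two_pow_mul_laurentMahlerMeasure a n hn i

theorem corollary1 (k : ℕ) (hk : 1 ≤ k) :
    {a : Fin k → ℤ | ∃ n : Fin k → ℤ, Function.Injective n ∧ n ⟨k - 1, by omega⟩ = 0 ∧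
        laurentMahlerMeasure (laurentOfTuple a n) = 1}.Finite ∧
      (2 ≤ k → ∀ a n : Fin k → ℤ, Function.Injective n → n ⟨k - 1, by omega⟩ = 0 →
        laurentMahlerMeasure (laurentOfTuple a n) = 1 →
          (laurentHeight (laurentOfTuple a n) : ℝ) ≤ 2 ^ (k - 2)) := by
  constructor
  · refine (Set.Finite.pi' fun _ : Fin k ↦ Set.finite_Icc (-2 ^ (k - 2) : ℤ) (2 ^ (k - 2))).subset ?_
    rintro a ⟨n, hn, -, h⟩ i
    have h1 := norm_le_of_laurentMahlerMeasure_eq_one hn h i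
    rw [Complex.norm_intCast] at h1
    have h2 : |a i| ≤ 2 ^ (k - 2) := by exact_mod_cast h1
    exact abs_le.1 h2
  · intro _ a n hn _ h
    have hle : laurentHeight (laurentOfTuple a n) ≤ 2 ^ (k - 2) := by
      refine Finset.sup_le fun j _ ↦ ?_
      rw [← NNReal.coe_le_coe, coe_nnnorm, coeff_laurentOfTuple]
      push_cast
      -- Distinct exponents never merge, so each coefficient is some `a i` or zero.
      by_cases hj : ∃ i, n i = j
      · obtain ⟨i, rfl⟩ := hj
        simpa [hn.eq_iff] using norm_le_of_laurentMahlerMeasure_eq_one hn h i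
      · rw [Finset.sum_eq_zero fun i _ ↦ if_neg fun hi ↦ hj ⟨i, hi⟩]
        simp
    exact_mod_cast hle
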